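/- Let $U=(U_n)_{n\ge 0}$ be a positional numeration system, i.e. a (strictly) increasing sequence of integers with $U_0=1$ and $\sup_n U_{n+1}/U_n<\infty$, and let $\mathrm{rep}_U(x)$ denote the greedy $U$-representation of $x\in\mathbb N$ (a word of length $\ell$, the least integer with $x<U_\ell$, most significant digit first). Suppose that $U$ has an associated alternate real base $B=(\beta_0,\ldots,\beta_{p-1})$, $p\ge1$: the $\beta_i\ge 1$ are real numbers with $\beta_i=\lim_{n\to\infty}U_{np-i}/U_{np-i-1}$ for $0\le i<p$; indices of $\beta$ are taken modulo $p$. For $0\le i<p$ let $\mathbf d_i=t_{i,0}t_{i,1}t_{i,2}\cdots$ be the greedy expansion of $1$ in the shifted base $(\beta_i,\ldots,\beta_{i+p-1})$, i.e. $r_0=1$, $t_{i,n}=\lfloor\beta_{i+n}r_n\rfloor$, $r_{n+1}=\beta_{i+n}r_n-t_{i,n}$. If $\mathbf d_i$ is finite, i.e. ends in a tail of zeros, let $\ell_i$ be the length of its prefix up to the last nonzero digit, put $\sigma(i)=(i+\ell_i)\bmod p$, and let $$(\Delta_i)_n=U_{np-i}-\sum_{\ell=1}^{\ell_i}t_{i,\ell-1}U_{np-i-\ell}\qquad(np-i\ge\ell_i);$$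 if $\mathbf d_i$ is not finite, $\sigma(i)$ is undefined. ($G$ is the directed graph on $\{0,\ldots,p-1\}$ with edges $i\to\sigma(i)$.) Finally let $L_i=\{\mathrm{rep}_U(U_{np-i}-1):n\ge1\}$. **Proposition.** Let $i\in\{0,\ldots,p-1\}$ and $r\ge1$ be such that $\sigma^r(i)$ is defined and $\sigma^r(i)=i$. If the languages $L_i,L_{\sigma(i)},\ldots,L_{\sigma^{r-1}(i)}$ are all regular, then the sequences $\Delta_i,\Delta_{\sigma(i)},\ldots,\Delta_{\sigma^{r-1}(i)}$ are all ultimately periodic. -/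

import Mathlib

open Filter Topology

/-- A positional numeration system: an increasing sequence of integers starting at `1`, with
uniformly bounded quotients of consecutive terms. -/
structure PositionalNumerationSystem where
  /-- the base sequence -/
  U : ℕ → ℕ
  strictMono : StrictMono U
  zero : U 0 = 1
  bounded : ∃ C : ℝ, ∀ n, (U (n + 1) : ℝ) / (U n : ℝ) ≤ C

namespace PositionalNumerationSystem

variable (S : PositionalNumerationSystem)

theorem exists_lt (x : ℕ) : ∃ l, x < S.U l :=
  ⟨x + 1, lt_of_lt_of_le (Nat.lt_succ_self x) (S.strictMono.le_apply)⟩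

/-- The `l` digits `a_{l-1} ⋯ a_0` (most significant first) that the greedy algorithm produces from
the remainder `r_l = r`, with `a_n = ⌊r_{n+1} / U_n⌋` and `r_n = r_{n+1} - a_n U_n`. -/
def greedyDigits : ℕ → ℕ → List ℕ
  | 0, _ => []
  | l + 1, r => (r / S.U l) :: greedyDigits l (r - (r / S.U l) * S.U l)

/-- The greedy `U`-representation of `x`; its length is the least `l` with `x < U_l`. -/
def rep (x : ℕ) : List ℕ :=
  S.greedyDigits (Nat.find (S.exists_lt x)) x

/-- The language `L_i = {rep_U(U_{np-i} - 1) : n ≥ 1}`, for `0 ≤ i < p`. Only finitely many letters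
of `ℕ` occur in it (they are bounded by the quotients `U_{n+1} / U_n`), so that regularity over the
alphabet `ℕ` is the same as regularity over a finite alphabet. -/
def maxLanguage {p : ℕ} (i : Fin p) : Language ℕ :=
  {w | ∃ n : ℕ, 1 ≤ n ∧ w = S.rep (S.U (n * p - (i : ℕ)) - 1)}

end PositionalNumerationSystem

/-- An alternate real base `(β_0, …, β_{p-1})`: a tuple of real numbers greater than or equal
to `1`. -/
structure AlternateBase (p : ℕ) where
  /-- the entries of the tuple -/
  base : Fin p → ℝ
  one_le : ∀ i, 1 ≤ base i

namespace AlternateBase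

variable {p : ℕ} [NeZero p] (B : AlternateBase p)

/-- The extension of the tuple to a periodic sequence, `β_n = β_{n mod p}`. -/
def beta (n : ℕ) : ℝ := B.base (Fin.ofNat p n)

/-- The circular shift `B^{(i)} = (β_i, …, β_{i+p-1})`. -/
def shift (i : ℕ) : AlternateBase p where
  base j := B.beta (i + (j : ℕ))
  one_le _ := B.one_le _

/-- The remainders of the greedy algorithm: `r_0 = x` and `r_{n+1} = β_n r_n - ⌊β_n r_n⌋`. -/
noncomputable def remainder (x : ℝ) : ℕ → ℝ
  | 0 => x
  | n + 1 => B.beta n * remainder x n - (⌊B.beta n * remainder x n⌋₊ : ℝ)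

/-- The digits `a_n = ⌊β_n r_n⌋` of the greedy expansion of `x ∈ [0, 1]`. -/
noncomputable def expansion (x : ℝ) (n : ℕ) : ℕ := ⌊B.beta n * B.remainder x n⌋₊

/-- `𝐝_i = t_{i,0} t_{i,1} ⋯`, the greedy `B^{(i)}`-expansion of `1`. (For `B = (1)` the algorithm
gives `1 0 0 0 ⋯`.) -/
noncomputable def d (i : Fin p) : ℕ → ℕ := (B.shift (i : ℕ)).expansion 1

/-- `𝐝_i` is finite, i.e. ends in a tail of zeros. -/
def FiniteExpansion (i : Fin p) : Prop := ∃ N, ∀ n, N ≤ n → B.d i n = 0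

/-- For finite `𝐝_i`, its length `ℓ_i`: the length of the prefix up to the last nonzero digit. -/
noncomputable def len (i : Fin p) : ℕ := sInf {N | ∀ n, N ≤ n → B.d i n = 0}

open Classical in
/-- The successor `σ(i) = (i + ℓ_i) mod p` of `i` in the graph `G` on `{0, …, p-1}`; it exists
exactly when `𝐝_i` is finite. The edges of `G` are the pairs `(i, σ(i))`. -/
noncomputable def sigma (i : Fin p) : Option (Fin p) :=
  if B.FiniteExpansion i then some (Fin.ofNat p ((i : ℕ) + B.len i)) else none

/-- The iterated successor `σ^h(i)`, where it exists. -/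
noncomputable def sigmaIter : ℕ → Fin p → Option (Fin p)
  | 0, i => some i
  | h + 1, i => (sigmaIter h i).bind B.sigma

/-- `B` is an alternate base associated with `U`: `β_i = lim_n U_{np-i} / U_{np-i-1}`. -/
def IsAssociated (S : PositionalNumerationSystem) : Prop :=
  ∀ i : Fin p, Tendsto
    (fun n : ℕ => (S.U (n * p - (i : ℕ)) : ℝ) / (S.U (n * p - (i : ℕ) - 1) : ℝ))
    atTop (𝓝 (B.base i))

/-- `(Δ_i)_n = U_{np-i} - ∑_{l=1}^{ℓ_i} t_{i,l-1} U_{np-i-l}`, meaningful for `np - i ≥ ℓ_i` (only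
large `n` matter). -/
noncomputable def Delta (S : PositionalNumerationSystem) (i : Fin p) (n : ℕ) : ℤ :=
  (S.U (n * p - (i : ℕ)) : ℤ) -
    ∑ l ∈ Finset.Icc 1 (B.len i), (B.d i (l - 1) : ℤ) * (S.U (n * p - (i : ℕ) - l) : ℤ)

end AlternateBase

/-- The sequence `x` is ultimately periodic. -/
def UltimatelyPeriodic (x : ℕ → ℤ) : Prop :=
  ∃ N M : ℕ, 1 ≤ M ∧ ∀ n, N ≤ n → x (n + M) = x n

/-! Write Δ at integer positions N and follow the cycle: from (k, N) pass to (k+1, N - ℓ), where ℓ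
is the length of the expansion at the k-th vertex. Let S_h(N) be the sum of the Δ-values met in h
steps. Since a finite expansion has remainder 0, every Δ, hence every S_h, is o(U_N).

These sums govern the greedy word of U_N - 1. While the sums stay nonpositive, each step writes the
expansion with its last digit lowered by one (`carryWord`) and leaves U + S_h - 1 to represent. At
the first positive sum it writes the unaltered expansion (`fullWord`) and leaves S_{h+1} - 1, which
begins with arbitrarily many zeros.

Regularity lets these words be pumped along N, N + M, N + 2M, …, for M divisible by enough
factorials. Prefixes of fixed length stabilise, so the sign of each sum in turn is eventually
constant. Tails do not move, so the first positive sum, if there is one, is eventually constant. If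
there is none, and M is a multiple of the length of the cycle, comparing the remainders at N and N +
M shows that the sum over M positions vanishes (`positiveAt_or_neverPositive`).

It remains to recover the single terms from the sums, which is purely combinatorial
(`eventuallyStable_of_dichotomy`). Finitely many progressions then cover all indices n. -/

/-! ### Orbit sums: from stable sums to stable terms -/

/-- The total decrement after `h` steps of an orbit that starts at index `k`. -/
def orbitOffset (lam : ℕ → ℤ) (k h : ℕ) : ℤ := ∑ u ∈ Finset.range h, lam (k + u)

/-- The sum of the values of `D` met during `h` steps of the orbit of `(k, N)` under
`(k, N) ↦ (k + 1, N - lam k)`. -/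
def orbitSum (lam : ℕ → ℤ) (D : ℕ → ℤ → ℤ) (h k : ℕ) (N : ℤ) : ℤ :=
  ∑ u ∈ Finset.range h, D (k + u) (N - orbitOffset lam k u)

section Orbit

variable {lam : ℕ → ℤ} {D : ℕ → ℤ → ℤ}

theorem orbitOffset_zero (k : ℕ) : orbitOffset lam k 0 = 0 := by simp [orbitOffset]

theorem orbitOffset_succ (k h : ℕ) :
    orbitOffset lam k (h + 1) = orbitOffset lam k h + lam (k + h) := by
  simp [orbitOffset, Finset.sum_range_succ]

theorem orbitOffset_add (k a b : ℕ) :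
    orbitOffset lam k (a + b) = orbitOffset lam k a + orbitOffset lam (k + a) b := by
  simp [orbitOffset, Finset.sum_range_add, add_assoc]

theorem orbitSum_zero (k : ℕ) (N : ℤ) : orbitSum lam D 0 k N = 0 := by simp [orbitSum]

theorem orbitSum_succ (h k : ℕ) (N : ℤ) : orbitSum lam D (h + 1) k N =
    orbitSum lam D h k N + D (k + h) (N - orbitOffset lam k h) := by
  simp [orbitSum, Finset.sum_range_succ]

theorem orbitSum_succ_left (h k : ℕ) (N : ℤ) : orbitSum lam D (h + 1) k N =
    ∑ u ∈ Finset.range h, D (k + (u + 1)) (N - orbitOffset lam k (u + 1)) + D k N := by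
  simp [orbitSum, Finset.sum_range_succ', orbitOffset_zero]

theorem orbitSum_add (a b k : ℕ) (N : ℤ) : orbitSum lam D (a + b) k N =
    orbitSum lam D a k N + orbitSum lam D b (k + a) (N - orbitOffset lam k a) := by
  simp [orbitSum, Finset.sum_range_add, orbitOffset_add, sub_sub, add_assoc]

theorem orbitOffset_periodic {Q : ℕ} (hlam : ∀ k, lam (k + Q) = lam k) (k h : ℕ) :
    orbitOffset lam (k + Q) h = orbitOffset lam k h := by
  unfold orbitOffset
  exact Finset.sum_congr rfl fun u _ => by rw [add_right_comm, hlam]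

theorem orbitSum_periodic {Q : ℕ} (hlam : ∀ k, lam (k + Q) = lam k)
    (hD : ∀ k, D (k + Q) = D k) (h k : ℕ) (N : ℤ) :
    orbitSum lam D h (k + Q) N = orbitSum lam D h k N := by
  unfold orbitSum
  exact Finset.sum_congr rfl fun u _ => by
    rw [add_right_comm, hD, orbitOffset_periodic hlam]

theorem orbitOffset_full_period {Q : ℕ} (hlam : ∀ k, lam (k + Q) = lam k) (k : ℕ) :
    orbitOffset lam k Q = orbitOffset lam 0 Q := by
  induction k with
  | zero => rfl
  | succ k ih =>
    have h1 := orbitOffset_add (lam := lam) k 1 Q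
    have h2 := orbitOffset_succ (lam := lam) k Q
    have h3 : orbitOffset lam k 1 = lam k := by simp [orbitOffset]
    rw [add_comm 1 Q] at h1
    rw [hlam] at h2
    linarith

theorem orbitOffset_mul_period {r : ℕ} (hlam : ∀ k, lam (k + r) = lam k) (k q : ℕ) :
    orbitOffset lam k (r * q) = q * orbitOffset lam 0 r := by
  induction q generalizing k with
  | zero => simp [orbitOffset]
  | succ q ih =>
    rw [Nat.mul_succ, orbitOffset_add, ih, orbitOffset_full_period hlam (k + r * q)]
    push_cast; ring

/-- `x` is eventually constant along the arithmetic progression `N, N + M, N + 2 M, …`. -/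
def EventuallyStable (M : ℤ) (x : ℤ → ℤ) (N : ℤ) : Prop :=
  ∀ᶠ m : ℕ in atTop, x (N + ((m : ℤ) + 1) * M) = x (N + m * M)

/-- Along `N, N + M, …`, the orbit sums first become positive after exactly `h + 1` steps, and
their value at that point is eventually constant. -/
def PositiveAt (lam : ℕ → ℤ) (D : ℕ → ℤ → ℤ) (M : ℤ) (h k : ℕ) (N : ℤ) : Prop :=
  (∀ u ≤ h, ∀ᶠ m : ℕ in atTop, orbitSum lam D u k (N + m * M) ≤ 0) ∧
  (∀ᶠ m : ℕ in atTop, 0 < orbitSum lam D (h + 1) k (N + m * M)) ∧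
  EventuallyStable M (orbitSum lam D (h + 1) k) N

/-- Along `N, N + M, …`, every orbit sum is eventually nonpositive, and the one over a full
period vanishes. -/
def NeverPositive (lam : ℕ → ℤ) (D : ℕ → ℤ → ℤ) (M : ℤ) (Q k : ℕ) (N : ℤ) : Prop :=
  (∀ h, ∀ᶠ m : ℕ in atTop, orbitSum lam D h k (N + m * M) ≤ 0) ∧
  ∀ᶠ m : ℕ in atTop, orbitSum lam D Q k (N + m * M) = 0

/-- The first term is the whole sum minus the later terms. -/
theorem EventuallyStable.of_orbitSum {M : ℤ} {b k : ℕ} {N : ℤ}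
    (hS : EventuallyStable M (orbitSum lam D (b + 1) k) N)
    (h : ∀ u < b, EventuallyStable M (D (k + (u + 1))) (N - orbitOffset lam k (u + 1))) :
    EventuallyStable M (D k) N := by
  have h' : ∀ᶠ m : ℕ in atTop, ∀ u ∈ Finset.range b,
      D (k + (u + 1)) (N - orbitOffset lam k (u + 1) + ((m : ℤ) + 1) * M) =
      D (k + (u + 1)) (N - orbitOffset lam k (u + 1) + m * M) :=
    (Filter.eventually_all_finset _).2 fun u hu => h u (Finset.mem_range.1 hu)
  filter_upwards [hS, h'] with m h1 h2
  rw [orbitSum_succ_left, orbitSum_succ_left] at h1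
  have h3 : ∑ u ∈ Finset.range b, D (k + (u + 1))
        (N + ((m : ℤ) + 1) * M - orbitOffset lam k (u + 1)) =
      ∑ u ∈ Finset.range b, D (k + (u + 1)) (N + m * M - orbitOffset lam k (u + 1)) :=
    Finset.sum_congr rfl fun u hu => by
      rw [add_sub_right_comm, h2 u hu, add_sub_right_comm]
  linarith

variable {M : ℤ} {Q : ℕ} {Good : ℕ → ℤ → Prop}

theorem good_orbit (hstep : ∀ k N, Good k N → Good (k + 1) (N - lam k)) {k : ℕ} {N : ℤ}
    (hg : Good k N) (u : ℕ) : Good (k + u) (N - orbitOffset lam k u) := by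
  induction u with
  | zero => simpa [orbitOffset_zero] using hg
  | succ u ih =>
    have := hstep _ _ ih
    rwa [sub_sub, ← orbitOffset_succ] at this

/-- Strong induction on `h`. The sum up to an intermediate point is nonpositive and the total is
positive, so the sum from that point on is positive. By the dichotomy the point is again of positive
type, with a smaller `h`, and its term is stable; subtracting these terms from the stable total
leaves the first one. -/
theorem PositiveAt.eventuallyStable
    (hstep : ∀ k N, Good k N → Good (k + 1) (N - lam k))
    (hdich : ∀ k N, Good k N → (∃ h, PositiveAt lam D M h k N) ∨ NeverPositive lam D M Q k N)
    (h : ℕ) : ∀ (k : ℕ) (N : ℤ), Good k N → PositiveAt lam D M h k N →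
      EventuallyStable M (D k) N := by
  induction h using Nat.strong_induction_on with
  | _ h ih =>
    intro k N hg hP
    refine hP.2.2.of_orbitSum fun u hu => ?_
    have hpos : ∀ᶠ m : ℕ in atTop, 0 < orbitSum lam D (h - u) (k + (u + 1))
        (N - orbitOffset lam k (u + 1) + m * M) := by
      filter_upwards [hP.1 (u + 1) (by omega), hP.2.1] with m h1 h2
      rw [show h + 1 = (u + 1) + (h - u) by omega, orbitSum_add, add_sub_right_comm] at h2
      linarith
    have hg' := good_orbit hstep hg (u + 1)
    rcases hdich _ _ hg' with ⟨h', hP'⟩ | hI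
    · refine ih h' ?_ _ _ hg' hP'
      by_contra hle
      obtain ⟨m, h1, h2⟩ := (hpos.and (hP'.1 (h - u) (by omega))).exists
      linarith
    · obtain ⟨m, h1, h2⟩ := (hpos.and (hI.1 (h - u))).exists
      exact absurd h2 (not_le.2 h1)

/-- In the never-positive case, go on to the next never-positive point of the orbit. The points
strictly between are of positive type, so their terms are stable, and it suffices that the sum over
the stretch is stable. -/
theorem eventuallyStable_of_dichotomy (hQ : 1 ≤ Q)
    (hlam : ∀ k, lam (k + Q) = lam k) (hD : ∀ k, D (k + Q) = D k)
    (hM : ∀ k, orbitOffset lam k Q = M)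
    (hstep : ∀ k N, Good k N → Good (k + 1) (N - lam k))
    (hdich : ∀ k N, Good k N → (∃ h, PositiveAt lam D M h k N) ∨ NeverPositive lam D M Q k N)
    {k : ℕ} {N : ℤ} (hg : Good k N) : EventuallyStable M (D k) N := by
  rcases hdich k N hg with ⟨h, hP⟩ | hI
  · exact hP.eventuallyStable hstep hdich h _ _ hg
  classical
  have hex : ∃ b, NeverPositive lam D M Q (k + (b + 1)) (N - orbitOffset lam k (b + 1)) := by
    -- After `Q` steps the orbit is back at the same index and at `N - M`, whose progression is that
    -- of `N` started one term earlier.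
    refine ⟨Q - 1, ?_⟩
    rw [Nat.sub_add_cancel hQ, hM]
    have key : ∀ P : ℤ → Prop, (∀ᶠ m : ℕ in atTop, P (N + m * M)) →
        ∀ᶠ m : ℕ in atTop, P (N - M + m * M) := by
      intro P hP
      rw [eventually_atTop] at hP ⊢
      obtain ⟨a, ha⟩ := hP
      refine ⟨a + 1, fun m hm => ?_⟩
      have := ha (m - 1) (by omega)
      rw [Nat.cast_sub (by omega)] at this
      convert this using 1
      push_cast; ring
    refine ⟨fun h => ?_, ?_⟩
    · simp only [orbitSum_periodic hlam hD]
      exact key (fun X => orbitSum lam D h k X ≤ 0) (hI.1 h)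
    · simp only [orbitSum_periodic hlam hD]
      exact key (fun X => orbitSum lam D Q k X = 0) hI.2
  have hb := Nat.find_spec hex
  have hmin : ∀ u < Nat.find hex, _ := fun u hu => Nat.find_min hex hu
  set b := Nat.find hex
  refine EventuallyStable.of_orbitSum (lam := lam) (b := b) ?_ fun u hu => ?_
  · have h1 : ∀ᶠ m : ℕ in atTop, orbitSum lam D Q k (N + ((m + 1 : ℕ) : ℤ) * M) = 0 :=
      (tendsto_add_atTop_nat 1).eventually hI.2
    have h2 : ∀ᶠ m : ℕ in atTop, orbitSum lam D Q (k + (b + 1))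
        (N - orbitOffset lam k (b + 1) + ((m + 1 : ℕ) : ℤ) * M) = 0 :=
      (tendsto_add_atTop_nat 1).eventually hb.2
    filter_upwards [h1, h2] with m h1 h2
    push_cast at h1 h2
    -- Split the sum over `Q + (b + 1)` steps from `N + (m + 1) * M` in two ways. Both full-period
    -- sums vanish, which equates the stretch sums at `N + m * M` and `N + (m + 1) * M`.
    have e1 := orbitSum_add (lam := lam) (D := D) Q (b + 1) k (N + ((m : ℤ) + 1) * M)
    have e2 := orbitSum_add (lam := lam) (D := D) (b + 1) Q k (N + ((m : ℤ) + 1) * M)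
    rw [orbitSum_periodic hlam hD, hM] at e1
    rw [add_comm (b + 1) Q, add_sub_right_comm, h2] at e2
    rw [h1, show N + ((m : ℤ) + 1) * M - M = N + m * M by ring] at e1
    linarith
  · have hg' := good_orbit hstep hg (u + 1)
    rcases hdich _ _ hg' with ⟨h', hP'⟩ | hI'
    · exact hP'.eventuallyStable hstep hdich h' _ _ hg'
    · exact absurd hI' (hmin u hu)

end Orbit

/-! ### Pumping with a prescribed length -/

theorem Language.IsRegular.exists_pumping {L : Language ℕ} (hL : L.IsRegular) :
    ∃ K : ℕ, ∀ M : ℕ, K.factorial ∣ M → ∀ w ∈ L, K ≤ w.length →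
      ∃ x y z : List ℕ, w = x ++ z ∧ y.length = M ∧ x.length ≤ K ∧
        ∀ m : ℕ, x ++ (List.replicate m y).flatten ++ z ∈ L := by
  obtain ⟨σ, _, A, rfl⟩ := hL
  refine ⟨Fintype.card σ, fun M hM w hw hlen => ?_⟩
  obtain ⟨a, b, c, rfl, hab, hb, hsub⟩ := A.pumping_lemma hw hlen
  have hbpos : 0 < b.length := List.length_pos_iff.2 hb
  have hdvd : b.length ∣ M := (Nat.dvd_factorial hbpos (by omega)).trans hM
  -- The pumped loop `b` is no longer than the number of states, so its length divides `M`. The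
  -- original `b` stays in the suffix, so that zero copies of `y` give back the word itself.
  refine ⟨a, (List.replicate (M / b.length) b).flatten, b ++ c, by simp, ?_, by omega,
    fun m => hsub ?_⟩
  · simp [Nat.div_mul_cancel hdvd]
  · refine Language.mem_mul.2 ⟨a ++ ((List.replicate m (List.replicate (M / b.length) b)).flatten
      ++ [b]).flatten, Language.mem_mul.2 ⟨a, rfl, _, Language.mem_kstar.2 ⟨_, rfl, ?_⟩, rfl⟩,
      c, rfl, ?_⟩
    · intro v hv
      simp only [List.mem_append, List.mem_flatten, List.mem_replicate, List.mem_singleton] at hv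
      rcases hv with ⟨l, ⟨_, rfl⟩, hv⟩ | rfl
      · exact (List.mem_replicate.1 hv).2
      · rfl
    · simp only [List.flatten_append, List.flatten_flatten, List.map_replicate,
        List.flatten_singleton, List.append_assoc]

/-! ### Greedy words of fixed length -/

namespace PositionalNumerationSystem

variable (S : PositionalNumerationSystem)

/-- The base sequence extended to integer positions, constant on the negative ones. -/
def ext (N : ℤ) : ℤ := S.U N.toNat

/-- The greedy digits of `X` in the positions below `N`. -/
def digits (N X : ℤ) : List ℕ := S.greedyDigits N.toNat X.toNat

/-- The greedy representation of the largest number whose representation has length `N`. -/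
def maxWord (N : ℤ) : List ℕ := S.digits N (S.ext N - 1)

theorem U_pos (n : ℕ) : 0 < S.U n := by
  have := S.strictMono.monotone (Nat.zero_le n)
  rw [S.zero] at this
  omega

theorem ext_pos (N : ℤ) : 0 < S.ext N := by
  unfold ext; exact_mod_cast S.U_pos _

theorem length_greedyDigits (l r : ℕ) : (S.greedyDigits l r).length = l := by
  induction l generalizing r with
  | zero => rfl
  | succ l ih => simp [greedyDigits, ih]

theorem length_digits (N X : ℤ) : (S.digits N X).length = N.toNat := S.length_greedyDigits _ _

theorem length_maxWord (N : ℤ) : (S.maxWord N).length = N.toNat := S.length_digits _ _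

/-- The leading digit is not bounded and `U 0 = 1`, so nothing of the number is lost. Length 0 has
to be excluded. -/
theorem greedyDigits_injective (l : ℕ) : Function.Injective (S.greedyDigits (l + 1)) := by
  induction l with
  | zero =>
    intro r r' h
    simpa [greedyDigits, S.zero] using h
  | succ l ih =>
    intro r r' h
    have h := List.cons.inj h
    have h1 := ih h.2
    have h2 := Nat.div_mul_le_self r (S.U (l + 1))
    have h3 := Nat.div_mul_le_self r' (S.U (l + 1))
    have h4 : r / S.U (l + 1) * S.U (l + 1) = r' / S.U (l + 1) * S.U (l + 1) := by rw [h.1]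
    omega

theorem eq_of_digits_eq {N X Y : ℤ} (hN : 1 ≤ N) (hX : 0 ≤ X) (hY : 0 ≤ Y)
    (h : S.digits N X = S.digits N Y) : X = Y := by
  unfold digits at h
  obtain ⟨l, hl⟩ : ∃ l, N.toNat = l + 1 := ⟨N.toNat - 1, by omega⟩
  rw [hl] at h
  have := S.greedyDigits_injective l h
  omega

theorem digits_mul_add {N Y : ℤ} (a : ℕ) (hN : 1 ≤ N) (hY : 0 ≤ Y) (hY' : Y < S.ext (N - 1)) :
    S.digits N (a * S.ext (N - 1) + Y) = a :: S.digits (N - 1) Y := by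
  obtain ⟨l, rfl⟩ : ∃ l : ℕ, N = l + 1 := ⟨(N - 1).toNat, by omega⟩
  obtain ⟨y, rfl⟩ := Int.eq_ofNat_of_zero_le hY
  simp only [ext, digits, add_sub_cancel_right, Int.toNat_natCast] at hY' ⊢
  have hy : y < S.U l := by exact_mod_cast hY'
  have e1 : ((l : ℤ) + 1).toNat = l + 1 := by omega
  have e2 : ((a : ℤ) * (S.U l : ℤ) + y).toNat = a * S.U l + y := by
    exact_mod_cast Int.toNat_natCast (a * S.U l + y)
  have e3 : (a * S.U l + y) / S.U l = a := by
    rw [add_comm, Nat.add_mul_div_right _ _ (S.U_pos l), Nat.div_eq_of_lt hy, zero_add]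
  rw [e1, e2, greedyDigits, e3, Nat.add_sub_cancel_left]

theorem rep_eq_maxWord {N : ℤ} (hN : 1 ≤ N) : S.rep (S.U N.toNat - 1) = S.maxWord N := by
  obtain ⟨l, rfl⟩ : ∃ l : ℕ, N = l + 1 := ⟨(N - 1).toNat, by omega⟩
  have e1 : ((l : ℤ) + 1).toNat = l + 1 := by omega
  have e2 : Nat.find (S.exists_lt (S.U (l + 1) - 1)) = l + 1 := by
    rw [Nat.find_eq_iff]
    have h0 := S.U_pos (l + 1)
    refine ⟨by omega, fun n hn h => ?_⟩
    have := S.strictMono hn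
    omega
  have e3 : ((S.U (l + 1) : ℤ) - 1).toNat = S.U (l + 1) - 1 := by omega
  rw [rep, e1, e2, maxWord, digits, ext, e1, e3]

theorem mem_maxLanguage {p : ℕ} {i : Fin p} {w : List ℕ} :
    w ∈ S.maxLanguage i ↔ ∃ N : ℤ, 1 ≤ N ∧ (p : ℤ) ∣ N + (i : ℕ) ∧ w = S.maxWord N := by
  have hi := i.2
  constructor
  · rintro ⟨n, hn, rfl⟩
    have h1 : p ≤ n * p := Nat.le_mul_of_pos_left _ hn
    have e : n * p - (i : ℕ) = ((n * p - (i : ℕ) : ℕ) : ℤ).toNat := by simp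
    refine ⟨((n * p - (i : ℕ) : ℕ) : ℤ), by omega, ⟨n, ?_⟩, ?_⟩
    · rw [Nat.cast_sub (by omega)]; push_cast; ring
    · rw [← S.rep_eq_maxWord (by omega), ← e]
  · rintro ⟨N, hN, ⟨q, hq⟩, rfl⟩
    have hq0 : 1 ≤ q := by
      by_contra h
      have : (p : ℤ) * q ≤ 0 := mul_nonpos_of_nonneg_of_nonpos (by positivity) (by omega)
      omega
    obtain ⟨n, rfl⟩ := Int.eq_ofNat_of_zero_le (by omega : 0 ≤ q)
    refine ⟨n, by omega, ?_⟩
    have : n * p - (i : ℕ) = N.toNat := by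
      have : ((n * p : ℕ) : ℤ) = N + (i : ℕ) := by rw [hq]; push_cast; ring
      omega
    rw [this, S.rep_eq_maxWord hN]

/-- The language has one word for each length in the residue class, so a pumped word is identified
by its length. -/
theorem exists_maxWord_pumping {p : ℕ} {i : Fin p} (hL : (S.maxLanguage i).IsRegular) :
    ∃ K : ℕ, ∀ M : ℕ, K.factorial ∣ M → ∀ N : ℤ, 1 ≤ N → (K : ℤ) ≤ N →
      (p : ℤ) ∣ N + (i : ℕ) → ∃ x y z : List ℕ, y.length = M ∧ x.length ≤ K ∧
        ∀ m : ℕ, S.maxWord (N + m * M) = x ++ (List.replicate m y).flatten ++ z := by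
  obtain ⟨K, hK⟩ := hL.exists_pumping
  refine ⟨K, fun M hM N hN1 hNK hN => ?_⟩
  obtain ⟨x, y, z, hw, hy, hx, hm⟩ := hK M hM (S.maxWord N) (S.mem_maxLanguage.2 ⟨N, hN1, hN, rfl⟩)
    (by rw [length_maxWord]; omega)
  refine ⟨x, y, z, hy, hx, fun m => ?_⟩
  obtain ⟨N', hN', -, h⟩ := S.mem_maxLanguage.1 (hm m)
  rw [h]
  congr 1
  have h1 := congrArg List.length h
  have h2 := congrArg List.length hw
  simp only [List.length_append, List.length_flatten, List.map_replicate, hy, List.sum_replicate,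
    smul_eq_mul, length_maxWord] at h1 h2
  have h3 : ((m * M : ℕ) : ℤ) = m * M := by push_cast; rfl
  omega

/-- The tail of the word `maxWord N` does not change when `N` grows by the pumping length, and any
prefix of it becomes constant. -/
theorem exists_maxWord_drop_take {p : ℕ} {i : Fin p} (hL : (S.maxLanguage i).IsRegular) :
    ∃ K : ℕ, ∀ M : ℕ, 1 ≤ M → K.factorial ∣ M → (p ∣ M) →
      (∀ N : ℤ, 1 ≤ N → (K : ℤ) ≤ N → (p : ℤ) ∣ N + (i : ℕ) → ∀ s, K ≤ s →
        (S.maxWord (N + M)).drop (s + M) = (S.maxWord N).drop s) ∧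
      ∀ N : ℤ, (p : ℤ) ∣ N + (i : ℕ) → ∀ s : ℕ, ∃ v : List ℕ,
        ∀ᶠ m : ℕ in atTop, (S.maxWord (N + m * M)).take s = v := by
  obtain ⟨K, hK⟩ := S.exists_maxWord_pumping hL
  refine ⟨K, fun M hM1 hKM hpM => ⟨fun N hN1 hNK hN s hs => ?_, fun N hN s => ?_⟩⟩
  · obtain ⟨x, y, z, hy, hx, hm⟩ := hK M hKM N hN1 hNK hN
    have h0 := hm 0
    have h1 := hm 1
    simp only [Nat.cast_zero, zero_mul, add_zero, List.replicate_zero, List.flatten_nil,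
      List.append_nil, Nat.cast_one, one_mul, List.replicate_one, List.flatten_cons] at h0 h1
    have hxy : (x ++ y).length = x.length + M := by rw [List.length_append, hy]
    have e1 : (x ++ y).drop (s + M) = [] := List.drop_eq_nil_of_le (by omega)
    have e2 : x.drop s = [] := List.drop_eq_nil_of_le (by omega)
    rw [h0, h1, List.drop_append (l₂ := z), List.drop_append (l₂ := z), e1, e2, hxy,
      Nat.add_sub_add_right]
  · obtain ⟨a, ha1, ha2⟩ : ∃ a : ℕ, 1 ≤ N + a * M ∧ (K : ℤ) ≤ N + a * M := by
      refine ⟨N.natAbs + K + 1, ?_⟩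
      have : ((N.natAbs + K + 1 : ℕ) : ℤ) * 1 ≤ ((N.natAbs + K + 1 : ℕ) : ℤ) * (M : ℤ) :=
        mul_le_mul_of_nonneg_left (by exact_mod_cast hM1) (by positivity)
      omega
    obtain ⟨x, y, z, hy, hx, hm⟩ := hK M hKM (N + a * M) ha1 ha2 (by
      rw [add_right_comm]
      exact dvd_add hN (dvd_mul_of_dvd_right (by exact_mod_cast hpM) _))
    -- As `M ≥ 1`, `s` copies of `y` already cover `s` letters.
    refine ⟨(x ++ (List.replicate s y).flatten).take s, ?_⟩
    filter_upwards [eventually_ge_atTop (a + s)] with m hmge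
    obtain ⟨c, rfl⟩ : ∃ c, m = a + (s + c) := ⟨m - (a + s), by omega⟩
    have e : N + ((a + (s + c) : ℕ) : ℤ) * M = N + a * M + ((s + c : ℕ) : ℤ) * M := by
      push_cast; ring
    rw [e, hm (s + c), List.replicate_add, List.flatten_append, ← List.append_assoc,
      List.append_assoc, List.take_append_of_le_length]
    simp only [List.length_append, List.length_flatten, List.map_replicate, hy,
      List.sum_replicate, smul_eq_mul]
    have : s * 1 ≤ s * M := Nat.mul_le_mul_left s hM1
    omega

end PositionalNumerationSystem

/-! ### Asymptotics along residue classes -/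

/-- The filter of large integers `N` with `N ≡ -j (mod p)`. -/
noncomputable def classFilter (p : ℕ) (j : ℤ) : Filter ℤ := atTop ⊓ 𝓟 {N | (p : ℤ) ∣ N + j}

theorem eventually_classFilter {p : ℕ} {j : ℤ} {P : ℤ → Prop} :
    (∀ᶠ N in classFilter p j, P N) ↔ ∃ a, ∀ N, a ≤ N → (p : ℤ) ∣ N + j → P N := by
  simp [classFilter, eventually_inf_principal, eventually_atTop]

theorem eventually_ge_classFilter (p : ℕ) (j c : ℤ) : ∀ᶠ N in classFilter p j, c ≤ N :=
  eventually_classFilter.2 ⟨c, fun _ h _ => h⟩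

theorem classFilter_congr {p : ℕ} {j j' : ℤ} (h : (p : ℤ) ∣ j' - j) :
    classFilter p j = classFilter p j' := by
  unfold classFilter
  congr 2
  ext N
  have e : N + j' = N + j + (j' - j) := by ring
  simp only [Set.mem_ofPred_eq]
  rw [e, dvd_add_left h]

theorem tendsto_sub_classFilter (p : ℕ) (j l : ℤ) :
    Tendsto (fun N => N - l) (classFilter p j) (classFilter p (j + l)) := by
  intro s hs
  obtain ⟨a, ha⟩ := eventually_classFilter.1 (show ∀ᶠ N in classFilter p (j + l), N ∈ s from hs)
  refine eventually_classFilter.2 ⟨a + l, fun N h1 h2 => ha _ (by linarith) ?_⟩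
  convert h2 using 1; ring

theorem tendsto_add_classFilter (p : ℕ) (j l : ℤ) :
    Tendsto (fun N => N + l) (classFilter p (j + l)) (classFilter p j) := by
  have := tendsto_sub_classFilter p (j + l) (-l)
  simpa using this

theorem tendsto_progression_classFilter {p M : ℕ} {j N : ℤ} (hM : 1 ≤ M) (hpM : p ∣ M)
    (hN : (p : ℤ) ∣ N + j) :
    Tendsto (fun m : ℕ => N + m * M) atTop (classFilter p j) := by
  refine tendsto_inf.2 ⟨?_, tendsto_principal.2 (Eventually.of_forall fun m => ?_)⟩
  · refine tendsto_atTop.2 fun b => ?_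
    filter_upwards [eventually_ge_atTop (b - N).toNat] with m hm
    have h : (m : ℤ) * 1 ≤ m * M :=
      mul_le_mul_of_nonneg_left (by exact_mod_cast hM) (by positivity)
    omega
  · show (p : ℤ) ∣ N + m * M + j
    rw [add_right_comm]
    exact dvd_add hN (dvd_mul_of_dvd_right (by exact_mod_cast hpM) _)

namespace PositionalNumerationSystem

variable (S : PositionalNumerationSystem)

theorem ext_mono : Monotone S.ext := fun a b h => by
  unfold ext
  exact_mod_cast S.strictMono.monotone (Int.toNat_le_toNat h)

theorem exists_ext_le : ∃ C : ℝ, ∀ N : ℤ, (S.ext N : ℝ) ≤ C * S.ext (N - 1) := by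
  obtain ⟨C, hC⟩ := S.bounded
  refine ⟨max C 1, fun N => ?_⟩
  have hpos : (0 : ℝ) < S.ext (N - 1) := by exact_mod_cast S.ext_pos _
  rcases le_or_gt N 0 with h | h
  · have : S.ext N = S.ext (N - 1) := by
      unfold ext; rw [Int.toNat_of_nonpos h, Int.toNat_of_nonpos (by omega)]
    rw [this]
    nlinarith [le_max_right C 1]
  · obtain ⟨n, rfl⟩ : ∃ n : ℕ, N = n + 1 := ⟨(N - 1).toNat, by omega⟩
    have h1 := hC n
    have e : S.ext ((n : ℤ) + 1) = S.U (n + 1) := by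
      unfold ext; congr 2
    have e' : S.ext ((n : ℤ) + 1 - 1) = S.U n := by unfold ext; simp
    rw [e'] at hpos ⊢
    rw [e]
    push_cast at hpos ⊢
    rw [div_le_iff₀ hpos] at h1
    exact h1.trans (mul_le_mul_of_nonneg_right (le_max_left _ _) hpos.le)

/-- This is where bounded quotients enter: being negligible against `U_N` and against `U_{N-q}` is
the same. -/
theorem ext_isBigO_sub (q : ℕ) :
    (fun N : ℤ => (S.ext N : ℝ)) =O[⊤] fun N : ℤ => (S.ext (N - q) : ℝ) := by
  induction q with
  | zero => simpa using Asymptotics.isBigO_refl (fun N : ℤ => (S.ext N : ℝ)) ⊤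
  | succ q ih =>
    obtain ⟨C, hC⟩ := S.exists_ext_le
    refine ih.trans (Asymptotics.IsBigO.of_bound C (Eventually.of_forall fun N => ?_))
    have h := hC (N - q)
    have h1 : (0 : ℝ) < S.ext (N - q) := by exact_mod_cast S.ext_pos _
    have h2 : (0 : ℝ) < S.ext (N - (q + 1 : ℕ)) := by exact_mod_cast S.ext_pos _
    rw [Real.norm_of_nonneg h1.le, Real.norm_of_nonneg h2.le]
    convert h using 4
    push_cast; ring

theorem ext_sub_isBigO (q : ℕ) :
    (fun N : ℤ => (S.ext (N - q) : ℝ)) =O[⊤] fun N : ℤ => (S.ext N : ℝ) := by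
  refine Asymptotics.IsBigO.of_bound 1 (Eventually.of_forall fun N => ?_)
  have h1 : (0 : ℝ) < S.ext (N - q) := by exact_mod_cast S.ext_pos _
  have h2 : (0 : ℝ) < S.ext N := by exact_mod_cast S.ext_pos _
  rw [Real.norm_of_nonneg h1.le, Real.norm_of_nonneg h2.le, one_mul]
  exact_mod_cast S.ext_mono (by omega)

/-- `f` is negligible with respect to the base sequence along `N ≡ -j (mod p)`. -/
def Negligible (p : ℕ) (j : ℤ) (f : ℤ → ℤ) : Prop :=
  (fun N => (f N : ℝ)) =o[classFilter p j] fun N => (S.ext N : ℝ)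

variable {S} {p : ℕ} {j : ℤ} {f g : ℤ → ℤ}

theorem Negligible.zero : S.Negligible p j fun _ => 0 := by
  simp [Negligible]

theorem Negligible.add (hf : S.Negligible p j f) (hg : S.Negligible p j g) :
    S.Negligible p j fun N => f N + g N := by
  simpa [Negligible] using Asymptotics.IsLittleO.add hf hg

theorem Negligible.comp_sub (l : ℕ) (hf : S.Negligible p (j + l) f) :
    S.Negligible p j fun N => f (N - l) :=
  (Asymptotics.IsLittleO.comp_tendsto hf (tendsto_sub_classFilter p j l)).trans_isBigO
    ((S.ext_sub_isBigO l).mono le_top)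

theorem Negligible.comp_add (l : ℕ) (hf : S.Negligible p j f) :
    S.Negligible p (j + l) fun N => f (N + l) := by
  refine (Asymptotics.IsLittleO.comp_tendsto hf (tendsto_add_classFilter p j l)).trans_isBigO
    (((S.ext_isBigO_sub l).comp_tendsto (k := fun N : ℤ => N + l) (l' := ⊤) tendsto_top).mono
      le_top |>.trans ?_)
  simpa [Function.comp_def] using Asymptotics.isBigO_refl _ _

theorem Negligible.eventually_abs_le (hf : S.Negligible p j f) (q : ℕ) {ε : ℝ} (hε : 0 < ε) :
    ∀ᶠ N in classFilter p j, |(f N : ℝ)| ≤ ε * S.ext (N - q) := by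
  have h := (Asymptotics.IsLittleO.trans_isBigO hf ((S.ext_isBigO_sub q).mono le_top)).bound hε
  filter_upwards [h] with N hN
  have h1 : (0 : ℝ) < S.ext (N - q) := by exact_mod_cast S.ext_pos _
  rwa [Real.norm_eq_abs, Real.norm_of_nonneg h1.le] at hN

theorem Negligible.eventually_abs_lt (hf : S.Negligible p j f) (q : ℕ) :
    ∀ᶠ N in classFilter p j, |f N| < S.ext (N - q) := by
  filter_upwards [hf.eventually_abs_le q (half_pos one_pos)] with N hN
  have h1 : (0 : ℝ) < S.ext (N - q) := by exact_mod_cast S.ext_pos _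
  have : |(f N : ℝ)| < S.ext (N - q) := by linarith
  exact_mod_cast this

theorem Negligible.eventually_digits (hf : S.Negligible p j f) (q : ℕ) :
    ∀ᶠ N in classFilter p j, 0 < f N →
      S.digits N (f N - 1) = List.replicate q 0 ++ S.digits (N - q) (f N - 1) := by
  induction q with
  | zero => exact Eventually.of_forall fun N _ => by simp
  | succ q ih =>
    filter_upwards [ih, hf.eventually_abs_lt (q + 1), eventually_ge_classFilter p j (q + 1)]
      with N h1 h2 h3 h4
    have e : N - (q + 1 : ℕ) = N - q - 1 := by push_cast; ring
    have h := S.digits_mul_add (N := N - q) (Y := f N - 1) 0 (by omega) (by omega)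
      (by rw [← e]; have := le_abs_self (f N); omega)
    rw [h1 h4, List.replicate_succ', List.append_assoc, e]
    congr 1
    simpa using h

end PositionalNumerationSystem

/-! ### Remainders as limits of residuals -/

namespace AlternateBase

variable {p : ℕ} [NeZero p] (B : AlternateBase p)

theorem one_le_beta (n : ℕ) : 1 ≤ B.beta n := B.one_le _

theorem beta_congr {m n : ℕ} (h : m % p = n % p) : B.beta m = B.beta n := by
  unfold beta
  congr 1
  exact Fin.ext h

theorem shift_beta (i n : ℕ) : (B.shift i).beta n = B.beta (i + n) := by
  show B.beta (i + n % p) = _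
  exact B.beta_congr (by simp)

theorem remainder_nonneg {x : ℝ} (hx : 0 ≤ x) (n : ℕ) : 0 ≤ B.remainder x n := by
  induction n with
  | zero => exact hx
  | succ n ih =>
    exact sub_nonneg.2 (Nat.floor_le (mul_nonneg (zero_le_one.trans (B.one_le_beta n)) ih))

theorem remainder_succ_lt_one (x : ℝ) (n : ℕ) : B.remainder x (n + 1) < 1 := by
  have := Nat.lt_floor_add_one (B.beta n * B.remainder x n)
  rw [remainder]; linarith

theorem remainder_succ (x : ℝ) (n : ℕ) :
    B.remainder x (n + 1) = B.beta n * B.remainder x n - B.expansion x n := rfl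

theorem one_le_expansion_one : 1 ≤ B.expansion 1 0 := by
  simpa [expansion, remainder, Nat.one_le_floor_iff] using B.one_le_beta 0

/-- When the expansion of `1` vanishes from some index on, so does the remainder. -/
theorem remainder_eq_zero {k : ℕ} (h : ∀ n, k ≤ n → B.expansion 1 n = 0) :
    B.remainder 1 k = 0 := by
  have hnn := B.remainder_nonneg zero_le_one
  have hk : k ≠ 0 := by
    rintro rfl
    have := B.one_le_expansion_one
    rw [h 0 le_rfl] at this
    omega
  by_cases hall : ∀ n, B.beta n = 1
  · have h1 : ∀ n, B.remainder 1 (n + 1) = 0 := by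
      intro n
      induction n with
      | zero => simp [remainder, hall]
      | succ n ih => rw [remainder, ih]; simp
    obtain ⟨k', rfl⟩ := Nat.exists_eq_succ_of_ne_zero hk
    exact h1 k'
  · push Not at hall
    obtain ⟨c, hc⟩ := hall
    have hb : 1 < B.beta c := lt_of_le_of_ne (B.one_le_beta c) (Ne.symm hc)
    have hstep : ∀ n, k ≤ n → B.remainder 1 (n + 1) = B.beta n * B.remainder 1 n := by
      intro n hn
      rw [remainder_succ, h n hn, Nat.cast_zero, sub_zero]
    have hmono : ∀ n, k ≤ n → ∀ u, B.remainder 1 n ≤ B.remainder 1 (n + u) := by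
      intro n hn u
      induction u with
      | zero => rfl
      | succ u ih =>
        rw [← add_assoc, hstep _ (by omega)]
        nlinarith [B.one_le_beta (n + u), hnn (n + u)]
    -- With zero digits the remainder never decreases and gains a factor `β_c > 1` once per period,
    -- which contradicts its bound by 1 unless it is zero.
    have hgrow : ∀ m : ℕ, B.beta c ^ m * B.remainder 1 k ≤ B.remainder 1 ((k + m) * p + c) := by
      intro m
      have hp : 1 ≤ p := NeZero.one_le
      have hkp : ∀ m, k ≤ (k + m) * p + c := fun m => by nlinarith
      induction m with
      | zero =>
        obtain ⟨u, hu⟩ := Nat.exists_eq_add_of_le (hkp 0)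
        rw [pow_zero, one_mul, hu]
        exact hmono k le_rfl u
      | succ m ih =>
        obtain ⟨q, rfl⟩ := Nat.exists_eq_add_of_le' hp
        have e : (k + (m + 1)) * (q + 1) + c = (k + m) * (q + 1) + c + 1 + q := by ring
        rw [e]
        refine le_trans ?_ (hmono _ (by have := hkp m; omega) q)
        rw [hstep _ (hkp m), pow_succ', mul_assoc]
        have e2 : B.beta ((k + m) * (q + 1) + c) = B.beta c := B.beta_congr (by simp)
        rw [e2]
        exact mul_le_mul_of_nonneg_left ih (by linarith)
    by_contra hne
    have hpos : 0 < B.remainder 1 k := lt_of_le_of_ne (hnn k) (Ne.symm hne)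
    obtain ⟨m, hm⟩ := pow_unbounded_of_one_lt (1 / B.remainder 1 k) hb
    rw [div_lt_iff₀ hpos] at hm
    have h2 := hgrow m
    obtain ⟨v, hv⟩ : ∃ v, (k + m) * p + c = v + 1 := by
      refine ⟨(k + m) * p + c - 1, ?_⟩
      have : 0 < (k + m) * p := Nat.mul_pos (by omega) (NeZero.pos p)
      omega
    rw [hv] at h2
    linarith [B.remainder_succ_lt_one 1 v]

variable {B} {S : PositionalNumerationSystem}

theorem IsAssociated.tendsto_ext (hB : B.IsAssociated S) (j : ℕ) :
    Tendsto (fun N : ℤ => (S.ext N : ℝ) / S.ext (N - 1)) (classFilter p j) (𝓝 (B.beta j)) := by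
  have hp : 0 < p := NeZero.pos p
  set i : Fin p := Fin.ofNat p j with hi
  have hij : (i : ℕ) = j % p := rfl
  have hdvd : (p : ℤ) ∣ (i : ℕ) - j := by
    rw [hij]; push_cast
    exact (Int.mod_modEq (j : ℤ) p).symm.dvd
  rw [classFilter_congr hdvd]
  have hn : Tendsto (fun N : ℤ => ((N + (i : ℕ)) / p).toNat) (classFilter p (i : ℕ)) atTop := by
    refine tendsto_atTop.2 fun b => ?_
    filter_upwards [eventually_ge_classFilter p (i : ℕ) (b * p)] with N hN
    have : (b : ℤ) ≤ (N + (i : ℕ)) / p := by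
      rw [Int.le_ediv_iff_mul_le (by exact_mod_cast hp)]; omega
    omega
  refine ((hB i).comp hn).congr' (eventually_classFilter.2 ⟨1, fun N hN hdv => ?_⟩)
  obtain ⟨q, hq⟩ := hdv
  have hq0 : 0 ≤ q := by
    by_contra h
    have : (p : ℤ) * q ≤ 0 := mul_nonpos_of_nonneg_of_nonpos (by positivity) (by omega)
    omega
  obtain ⟨n, rfl⟩ := Int.eq_ofNat_of_zero_le hq0
  have e : ((N + (i : ℕ)) / (p : ℤ)).toNat = n := by
    rw [hq, Int.mul_ediv_cancel_left _ (by exact_mod_cast hp.ne')]; simp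
  have e2 : ((n * p : ℕ) : ℤ) = N + (i : ℕ) := by rw [hq]; push_cast; ring
  have e3 : n * p - (i : ℕ) = N.toNat := by omega
  have e4 : N.toNat - 1 = (N - 1).toNat := by omega
  simp only [Function.comp_apply, e, e3, e4, PositionalNumerationSystem.ext, Int.cast_natCast]

variable (B S)

/-- What remains of `U_N` after subtracting the first `k` digits of the expansion `𝐝_i`, placed
below position `N`. -/
noncomputable def residual (i : Fin p) (k : ℕ) (N : ℤ) : ℤ :=
  S.ext N - ∑ l ∈ Finset.range k, (B.d i l : ℤ) * S.ext (N - (l + 1))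

theorem residual_succ (i : Fin p) (k : ℕ) (N : ℤ) :
    B.residual S i (k + 1) N = B.residual S i k N - B.d i k * S.ext (N - (k + 1)) := by
  simp [residual, Finset.sum_range_succ, sub_sub]

/-- Truncated subtraction agrees with `Int.toNat`, so no lower bound on `n` is needed. -/
theorem Delta_eq_residual (i : Fin p) (n : ℕ) :
    B.Delta S i n = B.residual S i (B.len i) (n * p - (i : ℕ)) := by
  have e : ∀ l : ℕ, S.ext (n * p - (i : ℕ) - l) = S.U (n * p - (i : ℕ) - l) := by
    intro l
    unfold PositionalNumerationSystem.ext
    congr 2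
    have : ((n * p : ℕ) : ℤ) = n * p := by push_cast; rfl
    omega
  have e0 := e 0
  simp only [Nat.cast_zero, sub_zero, Nat.sub_zero] at e0
  unfold Delta residual
  have hIcc : Finset.Icc 1 (B.len i) = Finset.Ico (0 + 1) (B.len i + 1) := by
    ext; simp only [Finset.mem_Icc, Finset.mem_Ico]; omega
  rw [e0, hIcc, Finset.range_eq_Ico, ← Finset.sum_Ico_add']
  congr 1
  refine Finset.sum_congr rfl fun l _ => ?_
  rw [← e]
  simp

variable {S}

theorem IsAssociated.tendsto_residual (hB : B.IsAssociated S) (i : Fin p) (k : ℕ) :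
    Tendsto (fun N : ℤ => (B.residual S i k N : ℝ) / S.ext (N - k)) (classFilter p (i : ℕ))
      (𝓝 ((B.shift i).remainder 1 k)) := by
  induction k with
  | zero =>
    refine tendsto_const_nhds.congr fun N => ?_
    have h : (S.ext N : ℝ) ≠ 0 := by exact_mod_cast (S.ext_pos N).ne'
    simp [residual, remainder, div_self h]
  | succ k ih =>
    have h1 := (hB.tendsto_ext ((i : ℕ) + k)).comp (by
      simpa using tendsto_sub_classFilter p (i : ℕ) k)
    have h2 := (h1.mul ih).sub_const ((B.d i k : ℕ) : ℝ)
    rw [remainder_succ, shift_beta]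
    refine h2.congr fun N => ?_
    have e : N - ((k + 1 : ℕ) : ℤ) = N - k - 1 := by push_cast; ring
    have e' : N - ((k : ℤ) + 1) = N - k - 1 := by ring
    have hk : (S.ext (N - k) : ℝ) ≠ 0 := by exact_mod_cast (S.ext_pos _).ne'
    have hk' : (S.ext (N - k - 1) : ℝ) ≠ 0 := by exact_mod_cast (S.ext_pos _).ne'
    rw [residual_succ, e, e']
    push_cast
    simp only [Function.comp_apply]
    field_simp

end AlternateBase

/-! ### Greedy words of numbers close to `U_N` -/

namespace AlternateBase

variable {p : ℕ} [NeZero p] {B : AlternateBase p} {S : PositionalNumerationSystem} {i : Fin p}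

theorem FiniteExpansion.d_eq_zero (h : B.FiniteExpansion i) {n : ℕ} (hn : B.len i ≤ n) :
    B.d i n = 0 :=
  Nat.sInf_mem (s := {N | ∀ n, N ≤ n → B.d i n = 0}) h n hn

theorem FiniteExpansion.one_le_len (h : B.FiniteExpansion i) : 1 ≤ B.len i := by
  by_contra hlt
  have h0 := h.d_eq_zero (n := 0) (by omega)
  have h1 : 1 ≤ B.d i 0 := (B.shift i).one_le_expansion_one
  omega

theorem FiniteExpansion.one_le_last (h : B.FiniteExpansion i) : 1 ≤ B.d i (B.len i - 1) := by
  by_contra hlt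
  have hlen := h.one_le_len
  refine Nat.notMem_of_lt_sInf (s := {N | ∀ n, N ≤ n → B.d i n = 0})
    (show B.len i - 1 < B.len i by omega) fun n hn => ?_
  rcases Nat.eq_or_lt_of_le hn with rfl | hn'
  · omega
  · exact h.d_eq_zero (by omega)

theorem IsAssociated.negligible_residual (hB : B.IsAssociated S) (h : B.FiniteExpansion i) :
    S.Negligible p (i : ℕ) (B.residual S i (B.len i)) := by
  have h1 := hB.tendsto_residual B i (B.len i)
  rw [(B.shift i).remainder_eq_zero fun n hn => h.d_eq_zero hn] at h1
  have h2 : (fun N => (B.residual S i (B.len i) N : ℝ)) =o[classFilter p (i : ℕ)]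
      fun N => (S.ext (N - B.len i) : ℝ) := by
    refine (Asymptotics.isLittleO_iff_tendsto fun N hN => ?_).2 h1
    exact absurd hN (by exact_mod_cast (S.ext_pos _).ne')
  exact h2.trans_isBigO ((S.ext_sub_isBigO _).mono le_top)

theorem IsAssociated.eventually_residual_lt (hB : B.IsAssociated S) {f : ℤ → ℤ}
    (hf : S.Negligible p (i : ℕ) f) (k : ℕ) :
    ∀ᶠ N in classFilter p (i : ℕ), B.residual S i (k + 1) N + f N < S.ext (N - (k + 1 : ℕ)) := by
  have hr := (B.shift i).remainder_succ_lt_one 1 k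
  set r := (B.shift i).remainder 1 (k + 1) with hrdef
  filter_upwards [(hB.tendsto_residual B i (k + 1)).eventually_lt_const
      (show r < (1 + r) / 2 by linarith),
    hf.eventually_abs_le (k + 1) (show 0 < (1 - r) / 4 by linarith)] with N h1 h2
  have hpos : (0 : ℝ) < S.ext (N - (k + 1 : ℕ)) := by exact_mod_cast S.ext_pos _
  rw [div_lt_iff₀ hpos] at h1
  have h3 := le_abs_self (f N : ℝ)
  have h4 : (B.residual S i (k + 1) N : ℝ) + f N < S.ext (N - (k + 1 : ℕ)) := by nlinarith
  exact_mod_cast h4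

/-- The residual ratio tends to a remainder below 1, so subtracting the digit of the expansion
leaves less than the next base element: that digit is the greedy one. Positivity keeps the number
left after the `- 1` nonnegative, and passes from `k + 1` to `k` because residuals decrease in `k`.
-/
theorem IsAssociated.eventually_digits_prefix (hB : B.IsAssociated S) {f : ℤ → ℤ}
    (hf : S.Negligible p (i : ℕ) f) (k : ℕ) :
    ∀ᶠ N in classFilter p (i : ℕ), 0 < B.residual S i k N + f N →
      S.digits N (S.ext N + f N - 1) =
        (List.range k).map (B.d i) ++ S.digits (N - k) (B.residual S i k N + f N - 1) := by
  induction k with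
  | zero => exact Eventually.of_forall fun N _ => by simp [residual]
  | succ k ih =>
    filter_upwards [ih, hB.eventually_residual_lt hf k,
      eventually_ge_classFilter p (i : ℕ) (k + 1)] with N h1 h2 h3 h4
    have e : N - (k + 1 : ℕ) = N - k - 1 := by push_cast; ring
    have e' : N - ((k : ℤ) + 1) = N - k - 1 := by ring
    have hres := B.residual_succ S i k N
    rw [e'] at hres
    rw [e] at h2
    have hd : 0 ≤ (B.d i k : ℤ) * S.ext (N - k - 1) :=
      mul_nonneg (by positivity) (S.ext_pos _).le
    have h := S.digits_mul_add (N := N - k) (Y := B.residual S i (k + 1) N + f N - 1) (B.d i k)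
      (by omega) (by omega) (by omega)
    rw [h1 (by omega), e, List.range_succ, List.map_append, List.append_assoc]
    congr 1
    convert h using 2
    · omega
    · rfl

variable (B) in
/-- The word of the nonzero part of `𝐝_i`. -/
noncomputable def fullWord (i : Fin p) : List ℕ := (List.range (B.len i)).map (B.d i)

variable (B) in
/-- The word of the nonzero part of `𝐝_i` with its last letter decreased by one. -/
noncomputable def carryWord (i : Fin p) : List ℕ :=
  (List.range (B.len i - 1)).map (B.d i) ++ [B.d i (B.len i - 1) - 1]

theorem length_fullWord : (B.fullWord i).length = B.len i := by simp [fullWord]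

theorem FiniteExpansion.length_carryWord (h : B.FiniteExpansion i) :
    (B.carryWord i).length = B.len i := by
  have := h.one_le_len
  simp only [carryWord, List.length_append, List.length_map, List.length_range,
    List.length_singleton]
  omega

theorem FiniteExpansion.fullWord_ne_carryWord (h : B.FiniteExpansion i) :
    B.fullWord i ≠ B.carryWord i := by
  have h1 := h.one_le_len
  have h2 := h.one_le_last
  obtain ⟨l, hl⟩ : ∃ l, B.len i = l + 1 := ⟨B.len i - 1, by omega⟩
  intro heq
  rw [hl] at h2
  simp only [fullWord, carryWord, hl, List.range_succ, List.map_append, List.map_cons,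
    List.map_nil, Nat.add_sub_cancel, List.append_cancel_left_eq, List.cons.injEq,
    and_true] at heq h2
  omega

theorem IsAssociated.eventually_fullWord (hB : B.IsAssociated S) {f : ℤ → ℤ}
    (hf : S.Negligible p (i : ℕ) f) :
    ∀ᶠ N in classFilter p (i : ℕ), 0 < f N + B.residual S i (B.len i) N →
      S.digits N (S.ext N + f N - 1) =
        B.fullWord i ++ S.digits (N - B.len i) (f N + B.residual S i (B.len i) N - 1) := by
  filter_upwards [hB.eventually_digits_prefix hf (B.len i)] with N h1 h2
  rw [add_comm (f N)] at h2 ⊢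
  exact h1 h2

/-- The full expansion would overshoot, so its last digit gives back one `U_{N-ℓ}`. The deficit is
negligible, so one unit is enough. -/
theorem IsAssociated.eventually_carryWord (hB : B.IsAssociated S) (h : B.FiniteExpansion i)
    {f : ℤ → ℤ} (hf : S.Negligible p (i : ℕ) f) :
    ∀ᶠ N in classFilter p (i : ℕ), f N + B.residual S i (B.len i) N ≤ 0 →
      S.digits N (S.ext N + f N - 1) =
        B.carryWord i ++ S.digits (N - B.len i)
          (S.ext (N - B.len i) + (f N + B.residual S i (B.len i) N) - 1) := by
  have hlen := h.one_le_len
  have hlast := h.one_le_last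
  have hneg := (hf.add (hB.negligible_residual h)).eventually_abs_lt (B.len i)
  unfold carryWord
  obtain ⟨l, hl⟩ : ∃ l, B.len i = l + 1 := ⟨B.len i - 1, by omega⟩
  rw [hl] at hlast hneg ⊢
  simp only [Nat.add_sub_cancel] at hlast ⊢
  filter_upwards [hB.eventually_digits_prefix hf l, hneg,
    eventually_ge_classFilter p (i : ℕ) (l + 1)] with N h1 h2 h3 h4
  have e : N - (l + 1 : ℕ) = N - l - 1 := by push_cast; ring
  have e' : N - ((l : ℤ) + 1) = N - l - 1 := by ring
  have hres := B.residual_succ S i l N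
  rw [e'] at hres
  rw [e] at h2 ⊢
  have h5 := neg_abs_le (f N + B.residual S i (l + 1) N)
  obtain ⟨a, ha⟩ : ∃ a, B.d i l = a + 1 := ⟨B.d i l - 1, by omega⟩
  rw [ha] at hres ⊢
  push_cast at hres
  have hd : 0 ≤ (a : ℤ) * S.ext (N - l - 1) := mul_nonneg (by positivity) (S.ext_pos _).le
  have hd' : ((a : ℤ) + 1) * S.ext (N - l - 1) = a * S.ext (N - l - 1) + S.ext (N - l - 1) := by
    ring
  rw [hd'] at hres
  have hdig := S.digits_mul_add (N := N - l)
    (Y := S.ext (N - l - 1) + (f N + B.residual S i (l + 1) N) - 1) a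
    (by omega) (by omega) (by omega)
  rw [h1 (by omega), List.append_assoc]
  congr 1
  convert hdig using 2
  · omega
  · rfl

end AlternateBase

/-! ### Maximal words along a cycle -/

/-- An infinite path in the graph `G` that repeats after `r` steps. -/
structure AlternateBase.Cycle {p : ℕ} [NeZero p] (B : AlternateBase p) (r : ℕ)
    (I : ℕ → Fin p) : Prop where
  finite : ∀ k, B.FiniteExpansion (I k)
  next : ∀ k, I (k + 1) = Fin.ofNat p ((I k : ℕ) + B.len (I k))
  periodic : ∀ k, I (k + r) = I k

namespace AlternateBase.Cycle

variable {p : ℕ} [NeZero p] {B : AlternateBase p} {S : PositionalNumerationSystem} {r : ℕ}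
  {I : ℕ → Fin p}

/-- The orbit sums of the sequences `Δ` along the path `I`. -/
noncomputable abbrev deltaSum (B : AlternateBase p) (S : PositionalNumerationSystem)
    (I : ℕ → Fin p) (h k : ℕ) (N : ℤ) : ℤ :=
  orbitSum (fun k => (B.len (I k) : ℤ)) (fun k => B.residual S (I k) (B.len (I k))) h k N

/-- The total length of `h` consecutive steps of the path `I`. -/
noncomputable def steps (B : AlternateBase p) (I : ℕ → Fin p) (k h : ℕ) : ℕ :=
  ∑ u ∈ Finset.range h, B.len (I (k + u))

theorem orbitOffset_eq_steps (k h : ℕ) :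
    orbitOffset (fun k => (B.len (I k) : ℤ)) k h = steps B I k h := by
  simp [orbitOffset, steps]

theorem steps_succ (k h : ℕ) :
    steps B I k (h + 1) = steps B I k h + B.len (I (k + h)) := by
  simp [steps, Finset.sum_range_succ]

theorem dvd_next (hI : B.Cycle r I) (k : ℕ) :
    (p : ℤ) ∣ (I (k + 1) : ℕ) - ((I k : ℕ) + B.len (I k) : ℤ) := by
  rw [hI.next]
  simp only [Fin.ofNat]
  push_cast
  exact (Int.mod_modEq _ _).symm.dvd

theorem dvd_steps (hI : B.Cycle r I) (k h : ℕ) :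
    (p : ℤ) ∣ (I (k + h) : ℕ) - ((I k : ℕ) + steps B I k h : ℤ) := by
  induction h with
  | zero => simp [steps]
  | succ h ih =>
    have e : ((I (k + (h + 1)) : ℕ) - ((I k : ℕ) + steps B I k (h + 1) : ℤ) : ℤ) =
        ((I (k + h) : ℕ) - ((I k : ℕ) + steps B I k h : ℤ)) +
        ((I (k + h + 1) : ℕ) - ((I (k + h) : ℕ) + B.len (I (k + h)) : ℤ)) := by
      rw [steps_succ, add_assoc k h 1]; push_cast; ring
    rw [e]
    exact dvd_add ih (hI.dvd_next (k + h))

theorem le_steps (hI : B.Cycle r I) (k h : ℕ) : h ≤ steps B I k h := by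
  induction h with
  | zero => simp
  | succ h ih =>
    have := (hI.finite (k + h)).one_le_len
    rw [steps_succ]; omega

theorem classFilter_steps (hI : B.Cycle r I) (k h : ℕ) :
    classFilter p (I (k + h) : ℕ) = classFilter p ((I k : ℕ) + steps B I k h) :=
  (classFilter_congr (hI.dvd_steps k h)).symm

theorem tendsto_steps (hI : B.Cycle r I) (k h : ℕ) :
    Tendsto (fun N : ℤ => N - steps B I k h) (classFilter p (I k : ℕ))
      (classFilter p (I (k + h) : ℕ)) := by
  rw [hI.classFilter_steps]
  exact tendsto_sub_classFilter _ _ _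

theorem deltaSum_succ (h k : ℕ) (N : ℤ) : deltaSum B S I (h + 1) k N =
    deltaSum B S I h k N +
      B.residual S (I (k + h)) (B.len (I (k + h))) (N - steps B I k h) := by
  rw [deltaSum, orbitSum_succ, orbitOffset_eq_steps]

theorem negligible_deltaSum (hI : B.Cycle r I) (hB : B.IsAssociated S) (h k : ℕ) :
    S.Negligible p (I k : ℕ) (deltaSum B S I h k) := by
  induction h with
  | zero =>
    have : deltaSum B S I 0 k = fun _ => 0 := by ext N; exact orbitSum_zero _ _
    rw [this]
    exact .zero
  | succ h ih =>
    have : deltaSum B S I (h + 1) k = fun N => deltaSum B S I h k N +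
        B.residual S (I (k + h)) (B.len (I (k + h))) (N - steps B I k h) := by
      ext N; exact deltaSum_succ _ _ _
    rw [this]
    refine ih.add (PositionalNumerationSystem.Negligible.comp_sub _ ?_)
    have h1 := hB.negligible_residual (hI.finite (k + h))
    unfold PositionalNumerationSystem.Negligible at h1 ⊢
    rwa [hI.classFilter_steps] at h1

/-- The concatenation of the words `carryWord` along `h` steps of the path `I`. -/
noncomputable def carryPrefix (B : AlternateBase p) (I : ℕ → Fin p) (k h : ℕ) : List ℕ :=
  ((List.range h).map fun u => B.carryWord (I (k + u))).flatten

theorem carryPrefix_succ (k h : ℕ) :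
    carryPrefix B I k (h + 1) = carryPrefix B I k h ++ B.carryWord (I (k + h)) := by
  simp [carryPrefix, List.range_succ]

theorem length_carryPrefix (hI : B.Cycle r I) (k h : ℕ) :
    (carryPrefix B I k h).length = steps B I k h := by
  induction h with
  | zero => simp [carryPrefix, steps]
  | succ h ih =>
    rw [carryPrefix_succ, List.length_append, ih, (hI.finite _).length_carryWord, steps_succ]

theorem negligible_shifted (hI : B.Cycle r I) (hB : B.IsAssociated S) (h k : ℕ) :
    S.Negligible p (I (k + h) : ℕ) fun N => deltaSum B S I h k (N + steps B I k h) := by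
  have := (hI.negligible_deltaSum hB h k).comp_add (steps B I k h)
  unfold PositionalNumerationSystem.Negligible at this ⊢
  rwa [hI.classFilter_steps]

theorem eventually_carryPrefix (hI : B.Cycle r I) (hB : B.IsAssociated S) (k h : ℕ) :
    ∀ᶠ N in classFilter p (I k : ℕ), (∀ u ≤ h, deltaSum B S I u k N ≤ 0) →
      S.maxWord N = carryPrefix B I k h ++ S.digits (N - steps B I k h)
        (S.ext (N - steps B I k h) + deltaSum B S I h k N - 1) := by
  induction h with
  | zero =>
    refine Eventually.of_forall fun N _ => ?_
    simp [carryPrefix, steps, PositionalNumerationSystem.maxWord, deltaSum, orbitSum_zero]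
  | succ h ih =>
    filter_upwards [ih, (hI.tendsto_steps k h).eventually
      (hB.eventually_carryWord (hI.finite (k + h)) (hI.negligible_shifted hB h k))]
      with N h1 h2 h3
    have h4 := h3 (h + 1) le_rfl
    rw [deltaSum_succ] at h4
    rw [h1 fun u hu => h3 u (by omega)]
    simp only [sub_add_cancel] at h2
    rw [h2 h4, carryPrefix_succ, List.append_assoc, deltaSum_succ, steps_succ, sub_sub]
    push_cast
    rfl

theorem eventually_fullWord (hI : B.Cycle r I) (hB : B.IsAssociated S) (k h : ℕ) :
    ∀ᶠ N in classFilter p (I k : ℕ), (∀ u ≤ h, deltaSum B S I u k N ≤ 0) →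
      0 < deltaSum B S I (h + 1) k N →
      S.maxWord N = (carryPrefix B I k h ++ B.fullWord (I (k + h))) ++
        S.digits (N - steps B I k (h + 1)) (deltaSum B S I (h + 1) k N - 1) := by
  filter_upwards [hI.eventually_carryPrefix hB k h, (hI.tendsto_steps k h).eventually
    (hB.eventually_fullWord (hI.negligible_shifted hB h k))] with N h1 h2 h3 h4
  rw [deltaSum_succ] at h4 ⊢
  rw [h1 h3]
  simp only [sub_add_cancel] at h2
  rw [h2 h4, List.append_assoc, steps_succ, sub_sub]
  push_cast
  rfl

end AlternateBase.Cycle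

/-! ### Consequences of pumping for the orbit sums -/

namespace AlternateBase.Cycle

variable {p : ℕ} [NeZero p] {B : AlternateBase p} {S : PositionalNumerationSystem} {r : ℕ}
  {I : ℕ → Fin p}

theorem eventually_drop_of_pos (hI : B.Cycle r I) (hB : B.IsAssociated S) (k h q : ℕ) :
    ∀ᶠ N in classFilter p (I k : ℕ), (∀ u ≤ h, deltaSum B S I u k N ≤ 0) →
      0 < deltaSum B S I (h + 1) k N →
      (S.maxWord N).drop (steps B I k (h + 1) + q) =
        S.digits (N - steps B I k (h + 1) - q) (deltaSum B S I (h + 1) k N - 1) := by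
  filter_upwards [hI.eventually_fullWord hB k h, (hI.tendsto_steps k (h + 1)).eventually
    ((hI.negligible_shifted hB (h + 1) k).eventually_digits q)] with N h1 h2 h3 h4
  simp only [sub_add_cancel] at h2
  have hlen : (carryPrefix B I k h ++ B.fullWord (I (k + h))).length = steps B I k (h + 1) := by
    rw [List.length_append, hI.length_carryPrefix, length_fullWord, steps_succ]
  rw [h1 h3 h4, h2 h4, ← List.drop_drop, ← hlen, List.drop_left]
  exact List.drop_left' (by simp)

theorem eventually_drop_of_nonpos (hI : B.Cycle r I) (hB : B.IsAssociated S) (k h : ℕ) :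
    ∀ᶠ N in classFilter p (I k : ℕ), (∀ u ≤ h, deltaSum B S I u k N ≤ 0) →
      (S.maxWord N).drop (steps B I k h) = S.digits (N - steps B I k h)
        (S.ext (N - steps B I k h) + deltaSum B S I h k N - 1) := by
  filter_upwards [hI.eventually_carryPrefix hB k h] with N h1 h2
  rw [h1 h2]
  exact List.drop_left' (hI.length_carryPrefix k h)

section Progression

variable {M K k : ℕ} {N : ℤ}

theorem eventually_sign (hI : B.Cycle r I) (hB : B.IsAssociated S)
    (hM : 1 ≤ M) (hpM : p ∣ M) (hN : (p : ℤ) ∣ N + (I k : ℕ))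
    (htake : ∀ s : ℕ, ∃ v : List ℕ, ∀ᶠ m : ℕ in atTop, (S.maxWord (N + m * M)).take s = v)
    {h : ℕ} (hle : ∀ u ≤ h, ∀ᶠ m : ℕ in atTop, deltaSum B S I u k (N + m * M) ≤ 0) :
    (∀ᶠ m : ℕ in atTop, deltaSum B S I (h + 1) k (N + m * M) ≤ 0) ∨
      ∀ᶠ m : ℕ in atTop, 0 < deltaSum B S I (h + 1) k (N + m * M) := by
  have hT := tendsto_progression_classFilter hM hpM hN
  obtain ⟨v, hv⟩ := htake (steps B I k (h + 1))
  have hall : ∀ᶠ m : ℕ in atTop, ∀ u ∈ Finset.range (h + 1),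
      deltaSum B S I u k (N + m * M) ≤ 0 :=
    (eventually_all_finset _).2 fun u hu => hle u (by have := Finset.mem_range.1 hu; omega)
  have hlen := hI.length_carryPrefix k (h + 1)
  -- The two possible prefixes have equal length and differ in their last letter, so the eventual
  -- prefix decides the sign.
  by_cases hvc : v = carryPrefix B I k (h + 1)
  · left
    filter_upwards [hv, hall, hT.eventually (hI.eventually_fullWord hB k h)] with m h1 h2 h3
    by_contra hpos
    have h4 := h3 (fun u hu => h2 u (Finset.mem_range.2 (by omega))) (not_le.1 hpos)
    have hlen' : (carryPrefix B I k h ++ B.fullWord (I (k + h))).length =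
        steps B I k (h + 1) := by
      rw [List.length_append, hI.length_carryPrefix, length_fullWord, steps_succ]
    rw [h4, List.take_left' hlen', hvc, carryPrefix_succ] at h1
    exact (hI.finite (k + h)).fullWord_ne_carryWord (List.append_cancel_left h1)
  · right
    filter_upwards [hv, hall, hT.eventually (hI.eventually_carryPrefix hB k (h + 1))]
      with m h1 h2 h3
    by_contra hpos
    have h4 := h3 fun u hu => by
      rcases Nat.lt_or_ge u (h + 1) with h5 | h5
      · exact h2 u (Finset.mem_range.2 h5)
      · rw [le_antisymm hu h5]; exact not_lt.1 hpos
    rw [h4, List.take_left' hlen] at h1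
    exact hvc h1.symm

theorem eventuallyStable_of_pos (hI : B.Cycle r I) (hB : B.IsAssociated S)
    (hM : 1 ≤ M) (hpM : p ∣ M) (hN : (p : ℤ) ∣ N + (I k : ℕ))
    (hdrop : ∀ N : ℤ, 1 ≤ N → (K : ℤ) ≤ N → (p : ℤ) ∣ N + (I k : ℕ) → ∀ s, K ≤ s →
        (S.maxWord (N + M)).drop (s + M) = (S.maxWord N).drop s)
    {h : ℕ} (hle : ∀ u ≤ h, ∀ᶠ m : ℕ in atTop, deltaSum B S I u k (N + m * M) ≤ 0)
    (hpos : ∀ᶠ m : ℕ in atTop, 0 < deltaSum B S I (h + 1) k (N + m * M)) :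
    EventuallyStable M (deltaSum B S I (h + 1) k) N := by
  have hT := tendsto_progression_classFilter hM hpM hN
  have hall : ∀ᶠ m : ℕ in atTop, ∀ u ∈ Finset.range (h + 1),
      deltaSum B S I u k (N + m * M) ≤ 0 :=
    (eventually_all_finset _).2 fun u hu => hle u (by have := Finset.mem_range.1 hu; omega)
  have hone : Tendsto (fun m : ℕ => m + 1) atTop atTop := tendsto_add_atTop_nat 1
  filter_upwards [hall, hone.eventually hall, hpos, hone.eventually hpos,
    -- Dropping `K` further zeros at `N`, and `K + M` at `N + M`, moves past the unpumped prefix and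
    -- leaves equal lengths; the surviving digits still determine the sum.
    hT.eventually (hI.eventually_drop_of_pos hB k h K),
    hone.eventually (hT.eventually (hI.eventually_drop_of_pos hB k h (K + M))),
    hT.eventually (eventually_ge_classFilter p _ (1 + K + steps B I k (h + 1)))]
    with m h1 h2 h3 h4 h5 h6 h7
  replace h5 := h5 (fun u hu => h1 u (Finset.mem_range.2 (by omega))) h3
  replace h6 := h6 (fun u hu => h2 u (Finset.mem_range.2 (by omega))) h4
  push_cast at h4 h6
  have e : N + ((m : ℤ) + 1) * M = N + m * M + M := by ring
  rw [e] at h4 h6 ⊢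
  have h8 := hdrop (N + m * M) (by omega) (by omega)
    (by rw [add_right_comm]; exact dvd_add hN (dvd_mul_of_dvd_right (by exact_mod_cast hpM) _))
    (steps B I k (h + 1) + K) (by omega)
  rw [add_assoc, h6, h5] at h8
  rw [show N + (m : ℤ) * M + M - steps B I k (h + 1) - (K + M) =
    N + m * M - steps B I k (h + 1) - K by ring] at h8
  have h9 := S.eq_of_digits_eq (by omega) (by omega) (by omega) h8
  omega

theorem steps_full_period (hI : B.Cycle r I) (k q : ℕ) :
    steps B I k (r * q) = q * steps B I 0 r := by
  have := orbitOffset_mul_period (lam := fun k => (B.len (I k) : ℤ))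
    (r := r) (fun k => by simp only [hI.periodic]) k q
  rw [orbitOffset_eq_steps, orbitOffset_eq_steps] at this
  exact_mod_cast this

theorem periodic_mul (hI : B.Cycle r I) (q k : ℕ) : I (k + r * q) = I k := by
  have : Function.Periodic I r := hI.periodic
  rw [mul_comm]
  exact this.nat_mul q k

theorem eventually_deltaSum_eq_zero (hI : B.Cycle r I) (hB : B.IsAssociated S)
    {q : ℕ} (hMq : M = q * steps B I 0 r)
    (hM : 1 ≤ M) (hpM : p ∣ M) (hN : (p : ℤ) ∣ N + (I k : ℕ))
    (hdrop : ∀ N : ℤ, 1 ≤ N → (K : ℤ) ≤ N → (p : ℤ) ∣ N + (I k : ℕ) → ∀ s, K ≤ s →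
        (S.maxWord (N + M)).drop (s + M) = (S.maxWord N).drop s)
    (hle : ∀ u, ∀ᶠ m : ℕ in atTop, deltaSum B S I u k (N + m * M) ≤ 0) :
    ∀ᶠ m : ℕ in atTop, deltaSum B S I (r * q) k (N + m * M) = 0 := by
  have hT := tendsto_progression_classFilter hM hpM hN
  have hall : ∀ h, ∀ᶠ m : ℕ in atTop, ∀ u ∈ Finset.range (h + 1),
      deltaSum B S I u k (N + m * M) ≤ 0 := fun h =>
    (eventually_all_finset _).2 fun u hu => hle u
  have hone : Tendsto (fun m : ℕ => m + 1) atTop atTop := tendsto_add_atTop_nat 1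
  -- From `N + M`, the extra `r * q` steps use up exactly `M` positions, so the remainders at `N`
  -- and `N + M` sit at the same height. `K` steps suffice to pass the unpumped prefix, each having
  -- length at least 1.
  have hs : steps B I k (r * q + K) = steps B I k K + M := by
    have h1 := orbitOffset_add (lam := fun k => (B.len (I k) : ℤ)) k (r * q) K
    rw [orbitOffset_periodic fun k => by simp only [hI.periodic_mul]] at h1
    simp only [orbitOffset_eq_steps, hI.steps_full_period] at h1
    omega
  have key : ∀ᶠ m : ℕ in atTop, deltaSum B S I (r * q) k (N + ((m + 1 : ℕ) : ℤ) * M) = 0 := by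
    filter_upwards [hall K, hone.eventually (hall (r * q + K)),
      hT.eventually (hI.eventually_drop_of_nonpos hB k K),
      hone.eventually (hT.eventually (hI.eventually_drop_of_nonpos hB k (r * q + K))),
      hT.eventually (eventually_ge_classFilter p _ (1 + K + steps B I k K)),
      hT.eventually ((hI.negligible_deltaSum hB K k).eventually_abs_lt (steps B I k K)),
      hone.eventually (hT.eventually ((hI.negligible_deltaSum hB (r * q + K) k).eventually_abs_lt
        (steps B I k (r * q + K))))]
      with m h1 h2 h3 h4 h5 h6 h7
    replace h3 := h3 fun u hu => h1 u (Finset.mem_range.2 (by omega))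
    replace h4 := h4 fun u hu => h2 u (Finset.mem_range.2 (by omega))
    have e : N + ((m + 1 : ℕ) : ℤ) * M = N + m * M + M := by push_cast; ring
    rw [e] at h4 h7 ⊢
    have h8 := hdrop (N + m * M) (by omega) (by omega)
      (by rw [add_right_comm]; exact dvd_add hN (dvd_mul_of_dvd_right (by exact_mod_cast hpM) _))
      (steps B I k K) (hI.le_steps k K)
    have e2 : N + (m : ℤ) * M + M - ((steps B I k K + M : ℕ) : ℤ) =
        N + m * M - steps B I k K := by push_cast; ring
    rw [hs, e2] at h4 h7
    rw [h3, h4] at h8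
    have h6' := (abs_lt.1 h6).1
    have h7' := (abs_lt.1 h7).1
    have h9 := S.eq_of_digits_eq (by omega) (by omega) (by omega) h8
    have h10 := orbitSum_add (lam := fun k => (B.len (I k) : ℤ))
      (D := fun k => B.residual S (I k) (B.len (I k))) (r * q) K k (N + m * M + M)
    rw [orbitSum_periodic (fun k => by simp only [hI.periodic_mul])
      (fun k => by simp only [hI.periodic_mul]), orbitOffset_eq_steps, hI.steps_full_period,
      ← hMq, add_sub_cancel_right] at h10
    simp only [deltaSum] at h9 ⊢
    omega
  rw [eventually_atTop] at key ⊢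
  obtain ⟨a, ha⟩ := key
  refine ⟨a + 1, fun m hm => ?_⟩
  have := ha (m - 1) (by omega)
  rwa [Nat.sub_add_cancel (by omega)] at this

theorem positiveAt_or_neverPositive (hI : B.Cycle r I) (hB : B.IsAssociated S)
    {q : ℕ} (hMq : M = q * steps B I 0 r)
    (hM : 1 ≤ M) (hpM : p ∣ M) (hN : (p : ℤ) ∣ N + (I k : ℕ))
    (hdrop : ∀ N : ℤ, 1 ≤ N → (K : ℤ) ≤ N → (p : ℤ) ∣ N + (I k : ℕ) → ∀ s, K ≤ s →
        (S.maxWord (N + M)).drop (s + M) = (S.maxWord N).drop s)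
    (htake : ∀ s : ℕ, ∃ v : List ℕ, ∀ᶠ m : ℕ in atTop, (S.maxWord (N + m * M)).take s = v) :
    (∃ h, PositiveAt (fun k => (B.len (I k) : ℤ))
      (fun k => B.residual S (I k) (B.len (I k))) M h k N) ∨
    NeverPositive (fun k => (B.len (I k) : ℤ))
      (fun k => B.residual S (I k) (B.len (I k))) M (r * q) k N := by
  by_cases hex : ∃ h, (∀ u ≤ h, ∀ᶠ m : ℕ in atTop, deltaSum B S I u k (N + m * M) ≤ 0) ∧
      ∀ᶠ m : ℕ in atTop, 0 < deltaSum B S I (h + 1) k (N + m * M)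
  · obtain ⟨h, h1, h2⟩ := hex
    exact Or.inl ⟨h, h1, h2, hI.eventuallyStable_of_pos hB hM hpM hN hdrop h1 h2⟩
  · push Not at hex
    have hle : ∀ h, ∀ u ≤ h, ∀ᶠ m : ℕ in atTop, deltaSum B S I u k (N + m * M) ≤ 0 := by
      intro h
      induction h with
      | zero =>
        intro u hu
        rw [Nat.le_zero.1 hu]
        exact Eventually.of_forall fun m => (orbitSum_zero _ _).le
      | succ h ih =>
        intro u hu
        rcases Nat.lt_or_ge u (h + 1) with h5 | h5
        · exact ih u (by omega)
        · rw [le_antisymm hu h5]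
          rcases hI.eventually_sign hB hM hpM hN htake ih with h6 | h6
          · exact h6
          · exact absurd (h6.mono fun _ h7 => not_le.2 h7) (hex h ih)
    exact Or.inr ⟨fun h => hle h h le_rfl,
      hI.eventually_deltaSum_eq_zero hB hMq hM hpM hN hdrop fun u => hle u u le_rfl⟩

end Progression

/-- A single modulus serves every vertex of the cycle: the product of the factorials of their
pumping constants. -/
theorem exists_pumping_length (hI : B.Cycle r I) (hr : 1 ≤ r)
    (hreg : ∀ k < r, (S.maxLanguage (I k)).IsRegular) :
    ∃ L : ℕ, 1 ≤ L ∧ ∀ M : ℕ, 1 ≤ M → L ∣ M → p ∣ M → ∀ k, ∃ K : ℕ,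
      (∀ N : ℤ, 1 ≤ N → (K : ℤ) ≤ N → (p : ℤ) ∣ N + (I k : ℕ) → ∀ s, K ≤ s →
        (S.maxWord (N + M)).drop (s + M) = (S.maxWord N).drop s) ∧
      ∀ N : ℤ, (p : ℤ) ∣ N + (I k : ℕ) → ∀ s : ℕ, ∃ v : List ℕ,
        ∀ᶠ m : ℕ in atTop, (S.maxWord (N + m * M)).take s = v := by
  choose! K hK using fun k (hk : k < r) => S.exists_maxWord_drop_take (hreg k hk)
  refine ⟨∏ k ∈ Finset.range r, (K k).factorial,
    Finset.prod_pos fun k _ => Nat.factorial_pos _, fun M hM hLM hpM k => ?_⟩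
  have hk : k % r < r := Nat.mod_lt _ hr
  have hper : Function.Periodic I r := hI.periodic
  have hdvd : (K (k % r)).factorial ∣ M :=
    (Finset.dvd_prod_of_mem (fun k => (K k).factorial) (Finset.mem_range.2 hk)).trans hLM
  refine ⟨K (k % r), ?_⟩
  rw [← hper.map_mod_nat k]
  exact hK (k % r) hk M hM hdvd hpM

theorem ultimatelyPeriodic_Delta (hI : B.Cycle r I) (hr : 1 ≤ r) (hB : B.IsAssociated S)
    (hreg : ∀ k < r, (S.maxLanguage (I k)).IsRegular) (k : ℕ) :
    UltimatelyPeriodic (B.Delta S (I k)) := by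
  obtain ⟨L, hL, hpump⟩ := hI.exists_pumping_length hr hreg
  have hp : 1 ≤ p := NeZero.one_le
  have hsteps : 1 ≤ steps B I 0 r := hr.trans (hI.le_steps 0 r)
  -- The shift `T * p` must be a multiple of `L` to pump, of `p` to keep the residue class, and of
  -- the cycle length to return to the same vertex. In the index `n` it becomes the period `T`.
  set T := L * steps B I 0 r with hT
  have hT1 : 1 ≤ T := Nat.mul_pos hL hsteps
  have hM1 : 1 ≤ T * p := Nat.mul_pos hT1 hp
  have hMq : T * p = (L * p) * steps B I 0 r := by rw [hT]; ring
  have hLM : L ∣ T * p := ⟨steps B I 0 r * p, by rw [hT]; ring⟩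
  have hpM : p ∣ T * p := dvd_mul_left _ _
  have hstable : ∀ N : ℤ, (p : ℤ) ∣ N + (I k : ℕ) →
      EventuallyStable ((T * p : ℕ) : ℤ) (B.residual S (I k) (B.len (I k))) N := fun N hN =>
    eventuallyStable_of_dichotomy (lam := fun k => (B.len (I k) : ℤ))
      (D := fun k => B.residual S (I k) (B.len (I k))) (Q := r * (L * p))
      (Good := fun k N => (p : ℤ) ∣ N + (I k : ℕ))
      (Nat.mul_pos hr (Nat.mul_pos hL hp))
      (fun k => by simp only [hI.periodic_mul]) (fun k => by simp only [hI.periodic_mul])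
      (fun k => by rw [orbitOffset_eq_steps, hI.steps_full_period, ← hMq])
      (fun k N hN => by
        have e : N - (B.len (I k) : ℤ) + (I (k + 1) : ℕ) =
            N + (I k : ℕ) + ((I (k + 1) : ℕ) - ((I k : ℕ) + B.len (I k) : ℤ)) := by ring
        show (p : ℤ) ∣ N - (B.len (I k) : ℤ) + (I (k + 1) : ℕ)
        rw [e]
        exact dvd_add hN (hI.dvd_next k))
      (fun k N hN => by
        obtain ⟨K, hdrop, htake⟩ := hpump (T * p) hM1 hLM hpM k
        exact hI.positiveAt_or_neverPositive hB hMq hM1 hpM hN hdrop (htake N hN))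
      hN
  -- The `T` progressions given by `n % T` exhaust all `n`, and share one threshold.
  have hall : ∀ᶠ m : ℕ in atTop, ∀ c ∈ Finset.range T,
      B.residual S (I k) (B.len (I k)) (c * p - (I k : ℕ) + ((m : ℤ) + 1) * (T * p : ℕ)) =
      B.residual S (I k) (B.len (I k)) (c * p - (I k : ℕ) + m * (T * p : ℕ)) :=
    (eventually_all_finset _).2 fun c _ => hstable _ (by simp)
  obtain ⟨a, ha⟩ := eventually_atTop.1 hall
  refine ⟨a * T, T, hT1, fun n hn => ?_⟩
  have h1 := ha (n / T) ((Nat.le_div_iff_mul_le hT1).2 hn) (n % T)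
    (Finset.mem_range.2 (Nat.mod_lt _ hT1))
  have h2 : ((n % T : ℕ) : ℤ) + (T : ℤ) * ((n / T : ℕ) : ℤ) = n := by
    exact_mod_cast Nat.mod_add_div n T
  rw [Delta_eq_residual, Delta_eq_residual]
  convert h1 using 2
  · rw [Nat.cast_add, ← h2]; push_cast; ring
  · rw [← h2]; push_cast; ring

end AlternateBase.Cycle

/-! ### From iterates of σ to a cycle, and the theorem -/

namespace AlternateBase

variable {p : ℕ} [NeZero p] {B : AlternateBase p} {i : Fin p} {r : ℕ}

theorem sigmaIter_add (a b : ℕ) (i : Fin p) :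
    B.sigmaIter (a + b) i = (B.sigmaIter a i).bind (B.sigmaIter b) := by
  induction b with
  | zero => cases h : B.sigmaIter a i <;> simp [sigmaIter]
  | succ b ih =>
    rw [← add_assoc, sigmaIter, ih, Option.bind_assoc]
    rfl

theorem exists_cycle (hr : 1 ≤ r) (hcycle : B.sigmaIter r i = some i) :
    ∃ I : ℕ → Fin p, (∀ k, B.sigmaIter k i = some (I k)) ∧ B.Cycle r I := by
  have hper : ∀ k, B.sigmaIter (r + k) i = B.sigmaIter k i := fun k => by
    rw [sigmaIter_add, hcycle]; rfl
  have hdef : ∀ k, ∃ j, B.sigmaIter k i = some j := by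
    have hmul : ∀ q, B.sigmaIter (r * q) i = some i := by
      intro q
      induction q with
      | zero => rfl
      | succ q ih => rw [Nat.mul_succ, add_comm, hper, ih]
    intro k
    -- The iterate `r * k ≥ k` is defined, hence so is the `k`-th.
    have h1 := hmul k
    obtain ⟨b, hb⟩ := Nat.exists_eq_add_of_le (Nat.le_mul_of_pos_left k hr)
    rw [hb, sigmaIter_add] at h1
    obtain ⟨j, hj, -⟩ := Option.bind_eq_some_iff.1 h1
    exact ⟨j, hj⟩
  choose I hI using hdef
  have hnext : ∀ k, B.sigma (I k) = some (I (k + 1)) := by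
    intro k
    have h1 := hI (k + 1)
    rwa [sigmaIter, hI k, Option.bind_some] at h1
  refine ⟨I, hI, ⟨fun k => ?_, fun k => ?_, fun k => ?_⟩⟩
  · by_contra h
    have := hnext k
    simp [sigma, h] at this
  · have h1 := hnext k
    unfold sigma at h1
    split at h1
    · exact (Option.some.inj h1).symm
    · simp at h1
  · have h1 := hper k
    rw [hI, hI, add_comm] at h1
    exact Option.some.inj h1

end AlternateBase

theorem mainTheorem9 (S : PositionalNumerationSystem) (p : ℕ) [NeZero p] (B : AlternateBase p)
    (hB : B.IsAssociated S) (i : Fin p) (r : ℕ) (hr : 1 ≤ r)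
    (hcycle : B.sigmaIter r i = some i)
    (hreg : ∀ h < r, ∀ j, B.sigmaIter h i = some j → (S.maxLanguage j).IsRegular) :
    ∀ h < r, ∃ j, B.sigmaIter h i = some j ∧ UltimatelyPeriodic (B.Delta S j) := by
  obtain ⟨I, hI, hcyc⟩ := AlternateBase.exists_cycle hr hcycle
  exact fun h _ => ⟨I h, hI h,
    hcyc.ultimatelyPeriodic_Delta hr hB (fun k hk => hreg k hk _ (hI k)) h⟩
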